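/- Let $n\ge 1$ be an integer, let $\|\cdot\|$ be the Euclidean norm on $\mathbb{R}^n$, and let $r>0$ be a real number. Let $g,f:\mathbb{R}^n\to\mathbb{R}$ be the functions $$g(x)=\frac{1-\|x\|^r}{1-\|x\|},\qquad f(x)=\frac{1-\|x\|}{1-\|x\|^r},$$ interpreted for $\|x\|=1$ as their limiting values $g(x)=r$ and $f(x)=1/r$. A continuous function $h:\mathbb{R}^n\to\mathbb{R}$ is called conditionally negative definite if for every $m$ and all $x_1,\dots,x_m\in\mathbb{R}^n$ the matrix $[h(x_i-x_j)]$ is symmetric and $\sum_{i,j}c_ic_jh(x_i-x_j)\le 0$ for all real $c_1,\dots,c_m$ with $\sum_i c_i=0$. A continuous nonnegative function $h$ is called infinitely divisible if for every $m$, all $x_1,\dots,x_m\in\mathbb{R}^n$ and every real $\alpha\ge 0$ the matrix $[h(x_i-x_j)^\alpha]$ is symmetric positive semidefinite (with the convention $0^0=1$). Then $g$ is conditionally negative definite if and only if $1\le r\le 3$. As a consequence, $f$ is infinitely divisible for $1\le r\le 3$. -/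

import Mathlib

/-- A real square matrix is conditionally negative definite if it is symmetric and
`⟨c, A c⟩ ≤ 0` for every vector `c` whose coordinates sum to zero. -/
def IsCndMatrix {m : ℕ} (A : Matrix (Fin m) (Fin m) ℝ) : Prop :=
  A.IsSymm ∧ ∀ c : Fin m → ℝ, ∑ i, c i = 0 → ∑ i, ∑ j, c i * A i j * c j ≤ 0

/-- A real square matrix with nonnegative entries is infinitely divisible if all its
Hadamard powers `[a i j ^ α]`, `α ≥ 0`, are (symmetric) positive semidefinite. -/
def IsInfDivMatrix {m : ℕ} (A : Matrix (Fin m) (Fin m) ℝ) : Prop :=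
  (∀ i j, 0 ≤ A i j) ∧
    ∀ α : ℝ, 0 ≤ α → (Matrix.of fun i j => A i j ^ α).PosSemidef

/-- A continuous real function is conditionally negative definite if all the matrices
`[g (x i - x j)]` are. -/
def IsCnd {E : Type*} [NormedAddCommGroup E] (g : E → ℝ) : Prop :=
  Continuous g ∧
    ∀ (m : ℕ) (x : Fin m → E), IsCndMatrix (Matrix.of fun i j => g (x i - x j))

/-- A continuous real function is infinitely divisible if all the matrices
`[f (x i - x j)]` are. -/
def IsInfDiv {E : Type*} [NormedAddCommGroup E] (f : E → ℝ) : Prop :=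
  Continuous f ∧
    ∀ (m : ℕ) (x : Fin m → E), IsInfDivMatrix (Matrix.of fun i j => f (x i - x j))

open Classical in
/-- `g(x) = (1 - ‖x‖^r) / (1 - ‖x‖)` on `ℝⁿ` with the Euclidean norm, with the limiting
value `r` on the unit sphere. -/
noncomputable def gFun (n : ℕ) (r : ℝ) (x : EuclideanSpace ℝ (Fin n)) : ℝ :=
  if ‖x‖ = 1 then r else (1 - ‖x‖ ^ r) / (1 - ‖x‖)

open Classical in
/-- `f(x) = (1 - ‖x‖) / (1 - ‖x‖^r)` on `ℝⁿ` with the Euclidean norm, with the limiting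
value `1 / r` on the unit sphere. -/
noncomputable def fFun (n : ℕ) (r : ℝ) (x : EuclideanSpace ℝ (Fin n)) : ℝ :=
  if ‖x‖ = 1 then 1 / r else (1 - ‖x‖) / (1 - ‖x‖ ^ r)

open MeasureTheory Set Filter Topology

/-! For sufficiency, put D = ‖x i - x j‖, so that D² is conditionally negative definite (cnd). By
Schoenberg and the Gamma integral 1/(D² + w²) is positive semidefinite, hence D²/(D² + w²) = 1 -
w²/(D² + w²) is cnd. Integrating this profile over w > 0 with suitable nonnegative weights gives
that D, D/(D + s) and D²/(D + s) are cnd (`isCndKernel_of_sq`, `IsCndKernel.div_add`,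
`IsCndKernel.sq_div_add`). For 0 < p < 1, (1 - t^p)/(1 - t) is a positive mixture of the functions
1/(t + l). With k = 1 or 2 and p = r - k, g is 1 (plus t if k = 2) plus t^k (1 - t^p)/(1 - t), hence
cnd; integer r gives 1, 1 + t, 1 + t + t².

Necessity tests two points for r ≥ 1, and 0, x, 2x with weights 1, -2, 1 as ‖x‖ → ∞ for r ≤ 3.
Finally f = 1/g, and negative powers of a positive cnd kernel are Gamma mixtures of the kernels
exp(-t g). -/

/-- The quadratic form `⟨c, K c⟩` of a real kernel `K`. -/
def quadForm {ι : Type*} [Fintype ι] (c : ι → ℝ) (K : ι → ι → ℝ) : ℝ :=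
  ∑ i, ∑ j, c i * K i j * c j

/-! ### Quadratic forms of kernels and their integrals -/

section QuadForm

variable {ι : Type*} [Fintype ι] (c : ι → ℝ)

lemma quadForm_add (K L : ι → ι → ℝ) :
    quadForm c (fun i j => K i j + L i j) = quadForm c K + quadForm c L := by
  simp only [quadForm, ← Finset.sum_add_distrib]
  exact Finset.sum_congr rfl fun i _ => Finset.sum_congr rfl fun j _ => by ring

lemma quadForm_mul_left (a : ℝ) (K : ι → ι → ℝ) :
    quadForm c (fun i j => a * K i j) = a * quadForm c K := by
  simp only [quadForm, Finset.mul_sum]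
  exact Finset.sum_congr rfl fun i _ => Finset.sum_congr rfl fun j _ => by ring

variable {c} in
lemma quadForm_const (hc : ∑ i, c i = 0) (a : ℝ) : quadForm c (fun _ _ => a) = 0 := by
  simp only [quadForm, ← Finset.mul_sum, hc, mul_zero, Finset.sum_const_zero]

lemma quadForm_integral {Ω : Type*} [MeasurableSpace Ω] {μ : Measure Ω} {k : ι → ι → Ω → ℝ}
    (hk : ∀ i j, Integrable (k i j) μ) :
    quadForm c (fun i j => ∫ w, k i j w ∂μ) = ∫ w, quadForm c (fun i j => k i j w) ∂μ := by
  have h (i j) : Integrable (fun w => c i * k i j w * c j) μ :=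
    ((hk i j).const_mul _).mul_const _
  simp only [quadForm]
  rw [integral_finsetSum _ fun i _ => integrable_finsetSum _ fun j _ => h i j]
  refine Finset.sum_congr rfl fun i _ => ?_
  rw [integral_finsetSum _ fun j _ => h i j]
  refine Finset.sum_congr rfl fun j _ => ?_
  rw [integral_mul_const, integral_const_mul]

lemma quadForm_integral_nonpos {Ω : Type*} [MeasurableSpace Ω] {μ : Measure Ω}
    {k : ι → ι → Ω → ℝ} (hk : ∀ i j, Integrable (k i j) μ)
    (h : ∀ᵐ w ∂μ, quadForm c (fun i j => k i j w) ≤ 0) :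
    quadForm c (fun i j => ∫ w, k i j w ∂μ) ≤ 0 := by
  rw [quadForm_integral c hk]
  exact integral_nonpos_of_ae h

lemma quadForm_integral_nonneg {Ω : Type*} [MeasurableSpace Ω] {μ : Measure Ω}
    {k : ι → ι → Ω → ℝ} (hk : ∀ i j, Integrable (k i j) μ)
    (h : ∀ᵐ w ∂μ, 0 ≤ quadForm c (fun i j => k i j w)) :
    0 ≤ quadForm c (fun i j => ∫ w, k i j w ∂μ) := by
  rw [quadForm_integral c hk]
  exact integral_nonneg_of_ae h

lemma posSemidef_of_iff_quadForm (K : ι → ι → ℝ) :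
    (Matrix.of K).PosSemidef ↔ (∀ i j, K i j = K j i) ∧ ∀ c, 0 ≤ quadForm c K := by
  rw [Matrix.posSemidef_iff_dotProduct_mulVec]
  refine and_congr ⟨fun h i j => ?_, fun h => ?_⟩ (forall_congr' fun c => ?_)
  · simpa using (h.apply i j).symm
  · exact Matrix.IsHermitian.ext fun i j => by simpa using h j i
  · simp [quadForm, dotProduct, Matrix.mulVec, Finset.mul_sum, mul_assoc]

end QuadForm

/-! ### Schoenberg's theorem and negative powers -/

section Schoenberg

variable {ι : Type*} [Fintype ι]

lemma posSemidef_of_pow {K : ι → ι → ℝ} (hK : (Matrix.of K).PosSemidef) (k : ℕ) :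
    (Matrix.of fun i j => K i j ^ k).PosSemidef := by
  induction k with
  | zero =>
    convert Matrix.posSemidef_vecMulVec_self_star (fun _ : ι => (1 : ℝ)) using 1
    ext i j
    simp [Matrix.vecMulVec]
  | succ k ih =>
    have e : (Matrix.of fun i j => K i j ^ (k + 1)) =
        (Matrix.of fun i j => K i j ^ k).hadamard (Matrix.of K) := by
      ext i j
      simp [pow_succ]
    rw [e]
    exact ih.hadamard hK

/-- The exponential series has nonnegative coefficients, and Hadamard powers are positive
semidefinite by Schur's product theorem. -/
lemma posSemidef_of_exp {K : ι → ι → ℝ} (hK : (Matrix.of K).PosSemidef) :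
    (Matrix.of fun i j => Real.exp (K i j)).PosSemidef := by
  rw [posSemidef_of_iff_quadForm]
  refine ⟨fun i j => by rw [((posSemidef_of_iff_quadForm K).1 hK).1 i j], fun c => ?_⟩
  have hs (i j : ι) : HasSum (fun k : ℕ => c i * (K i j ^ k / k.factorial) * c j)
      (c i * Real.exp (K i j) * c j) := by
    refine HasSum.mul_right _ (HasSum.mul_left _ ?_)
    rw [Real.exp_eq_exp_ℝ]
    exact NormedSpace.expSeries_div_hasSum_exp (K i j)
  have h := hasSum_sum fun i (_ : i ∈ Finset.univ) =>
    hasSum_sum fun j (_ : j ∈ Finset.univ) => hs i j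
  refine h.nonneg fun k => ?_
  have hk := ((posSemidef_of_iff_quadForm _).1 (posSemidef_of_pow hK k)).2 c
  have := mul_nonneg (inv_nonneg.2 (Nat.cast_nonneg (α := ℝ) k.factorial)) hk
  rw [← quadForm_mul_left] at this
  simpa only [quadForm, div_eq_inv_mul] using this

/-- The kernel `K` is conditionally negative definite. -/
def IsCndKernel (K : ι → ι → ℝ) : Prop :=
  (∀ i j, K i j = K j i) ∧ ∀ c : ι → ℝ, ∑ i, c i = 0 → quadForm c K ≤ 0

lemma isCndMatrix_of_iff {m : ℕ} (K : Fin m → Fin m → ℝ) :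
    IsCndMatrix (Matrix.of K) ↔ IsCndKernel K := by
  refine and_congr ⟨fun h i j => (h.apply i j).symm, fun h => ?_⟩ Iff.rfl
  exact Matrix.IsSymm.ext fun i j => h j i

lemma IsCndKernel.posSemidef_base {K : ι → ι → ℝ} (hK : IsCndKernel K) (o : ι) :
    (Matrix.of fun i j => K i o + K o j - K i j - K o o).PosSemidef := by
  classical
  rw [posSemidef_of_iff_quadForm]
  refine ⟨fun i j => by rw [hK.1 i o, hK.1 o j, hK.1 i j]; ring, fun c => ?_⟩
  set s := ∑ i, c i with hs
  -- Moving the mass -s to the base point o makes the weights sum to zero.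
  have h := hK.2 (fun i => c i - s * if i = o then 1 else 0) (by
    simp [Finset.sum_sub_distrib, ← hs])
  have e : quadForm (fun i => c i - s * if i = o then 1 else 0) K =
      quadForm c K - s * ∑ j, K o j * c j - s * ∑ i, c i * K i o + s * s * K o o := by
    have (i j : ι) : (c i - s * if i = o then 1 else 0) * K i j *
        (c j - s * if j = o then 1 else 0) = c i * K i j * c j
        - s * (if i = o then K i j * c j else 0) - s * (if j = o then c i * K i j else 0)
        + s * s * (if i = o then if j = o then K i j else 0 else 0) := by
      split_ifs <;> ring
    simp only [quadForm, this, Finset.sum_add_distrib, Finset.sum_sub_distrib, ← Finset.mul_sum]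
    have h1 : ∑ i, ∑ j, (if i = o then K i j * c j else 0) = ∑ j, K o j * c j := by
      rw [Finset.sum_comm]; simp
    have h2 : ∑ i, ∑ j, (if i = o then if j = o then K i j else 0 else 0) = K o o := by
      rw [Finset.sum_comm]; simp
    rw [h1, h2]
    simp
  have e' : quadForm c (fun i j => K i o + K o j - K i j - K o o) =
      s * ∑ i, c i * K i o + s * ∑ j, K o j * c j - quadForm c K - s * s * K o o := by
    have (i j : ι) : c i * (K i o + K o j - K i j - K o o) * c j =
        (c i * K i o) * c j + c i * (K o j * c j) - c i * K i j * c j - c i * (c j * K o o) := by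
      ring
    simp only [quadForm, this, Finset.sum_add_distrib, Finset.sum_sub_distrib, ← Finset.mul_sum,
      ← Finset.sum_mul, ← hs]
    ring
  linarith

/-- **Schoenberg's theorem**: `exp (-K)` is positive semidefinite for a conditionally negative
definite kernel `K`. -/
lemma IsCndKernel.posSemidef_exp_neg {K : ι → ι → ℝ} (hK : IsCndKernel K) :
    (Matrix.of fun i j => Real.exp (-K i j)).PosSemidef := by
  rcases isEmpty_or_nonempty ι with h | ⟨⟨o⟩⟩
  · rw [posSemidef_of_iff_quadForm]
    exact ⟨fun i => h.elim i, fun c => by simp [quadForm]⟩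
  have h1 := posSemidef_of_exp (hK.posSemidef_base o)
  -- This rank-one factor cancels the base point terms; each side carries half of K o o.
  have h2 := Matrix.posSemidef_vecMulVec_self_star
    (fun i : ι => Real.exp (-K i o + K o o / 2))
  have h3 := h1.hadamard h2
  have e : (Matrix.of fun i j => Real.exp (-K i j)) =
      (Matrix.of fun i j => Real.exp (K i o + K o j - K i j - K o o)).hadamard
      (Matrix.vecMulVec (fun i => Real.exp (-K i o + K o o / 2))
        (star fun i => Real.exp (-K i o + K o o / 2))) := by
    ext i j
    simp only [Matrix.of_apply, Matrix.hadamard_apply, Matrix.vecMulVec_apply,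
      star_trivial, ← Real.exp_add]
    congr 1
    rw [hK.1 o j]
    ring
  rw [e]
  exact h3

lemma IsCndKernel.mul_left {K : ι → ι → ℝ} (hK : IsCndKernel K) {a : ℝ} (ha : 0 ≤ a) :
    IsCndKernel fun i j => a * K i j :=
  ⟨fun i j => by simp only [hK.1 i j], fun c hc => by
    rw [quadForm_mul_left]; exact mul_nonpos_of_nonneg_of_nonpos ha (hK.2 c hc)⟩

lemma IsCndKernel.add {K L : ι → ι → ℝ} (hK : IsCndKernel K) (hL : IsCndKernel L) :
    IsCndKernel fun i j => K i j + L i j :=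
  ⟨fun i j => by simp only [hK.1 i j, hL.1 i j], fun c hc => by
    rw [quadForm_add]; exact add_nonpos (hK.2 c hc) (hL.2 c hc)⟩

lemma isCndKernel_const (a : ℝ) : IsCndKernel fun _ _ : ι => a :=
  ⟨fun _ _ => rfl, fun _ hc => (quadForm_const hc a).le⟩

lemma IsCndKernel.integral {Ω : Type*} [MeasurableSpace Ω] {μ : Measure Ω} {k : ι → ι → Ω → ℝ}
    (hk : ∀ i j, Integrable (k i j) μ) (h : ∀ᵐ w ∂μ, IsCndKernel fun i j => k i j w) :
    IsCndKernel fun i j => ∫ w, k i j w ∂μ := by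
  refine ⟨fun i j => integral_congr_ae ?_, fun c hc => quadForm_integral_nonpos c hk ?_⟩
  · filter_upwards [h] with w hw using hw.1 i j
  · filter_upwards [h] with w hw using hw.2 c hc

/-- A positive conditionally negative definite kernel has positive semidefinite negative powers. -/
lemma IsCndKernel.posSemidef_inv_rpow {K : ι → ι → ℝ} (hK : IsCndKernel K)
    (hpos : ∀ i j, 0 < K i j) {α : ℝ} (hα : 0 < α) :
    (Matrix.of fun i j => (1 / K i j) ^ α).PosSemidef := by
  have hΓ := Real.Gamma_pos_of_pos hα
  have e (i j : ι) : (1 / K i j) ^ α = (Real.Gamma α)⁻¹ *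
      ∫ t in Ioi (0 : ℝ), t ^ (α - 1) * Real.exp (-(K i j * t)) := by
    rw [Real.integral_rpow_mul_exp_neg_mul_Ioi hα (hpos i j)]
    field_simp
  rw [posSemidef_of_iff_quadForm]
  refine ⟨fun i j => by rw [hK.1 i j], fun c => ?_⟩
  simp only [e]
  rw [quadForm_mul_left]
  refine mul_nonneg (inv_nonneg.2 hΓ.le) (quadForm_integral_nonneg c (fun i j => ?_) ?_)
  · have := integrableOn_rpow_mul_exp_neg_mul_rpow (p := 1) (s := α - 1) (by linarith) one_pos
      (hpos i j)
    simpa [IntegrableOn] using this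
  · refine (ae_restrict_iff' measurableSet_Ioi).2 (ae_of_all _ fun t ht => ?_)
    rw [quadForm_mul_left]
    refine mul_nonneg (Real.rpow_nonneg (mem_Ioi.1 ht).le _) ?_
    have := ((posSemidef_of_iff_quadForm _).1
      (hK.mul_left (mem_Ioi.1 ht).le).posSemidef_exp_neg).2 c
    simpa only [mul_comm t] using this

end Schoenberg

/-! ### Integral representations of cnd profiles -/

section Profiles

variable {ι : Type*} [Fintype ι]

/-- When the weights sum to zero, the form equals -2‖∑ c i • x i‖². -/
lemma isCndKernel_norm_sub_sq {E : Type*} [NormedAddCommGroup E] [InnerProductSpace ℝ E]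
    (x : ι → E) : IsCndKernel fun i j => ‖x i - x j‖ ^ 2 := by
  refine ⟨fun i j => by simp only [norm_sub_rev (x i)], fun c hc => ?_⟩
  have h : 0 ≤ inner ℝ (∑ i, c i • x i) (∑ j, c j • x j) := real_inner_self_nonneg
  simp only [sum_inner, inner_sum, inner_smul_left, inner_smul_right, RCLike.conj_to_real] at h
  have (i j : ι) : c i * ‖x i - x j‖ ^ 2 * c j = c i * ‖x i‖ ^ 2 * c j
      + c i * (‖x j‖ ^ 2 * c j) - 2 * (c i * (c j * inner ℝ (x i) (x j))) := by
    rw [norm_sub_sq_real]; ring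
  simp only [quadForm, this, Finset.sum_add_distrib, Finset.sum_sub_distrib, ← Finset.mul_sum,
    ← Finset.sum_mul, hc]
  have e : ∑ i, c i * ∑ j, c j * inner ℝ (x j) (x i) =
      ∑ i, c i * ∑ j, c j * inner ℝ (x i) (x j) := by simp only [real_inner_comm]
  linarith

/-- The profile `t ↦ t² / (t² + w²)`. -/
noncomputable def cauchyProfile (t w : ℝ) : ℝ := t ^ 2 / (t ^ 2 + w ^ 2)

lemma IsCndKernel.cauchyProfile {D : ι → ι → ℝ} (hD : IsCndKernel fun i j => D i j ^ 2)
    {w : ℝ} (hw : 0 < w) : IsCndKernel fun i j => cauchyProfile (D i j) w := by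
  have hpos (i j) : 0 < D i j ^ 2 + w ^ 2 := by positivity
  have h := (posSemidef_of_iff_quadForm _).1
    ((hD.add (isCndKernel_const (w ^ 2))).posSemidef_inv_rpow hpos one_pos)
  simp only [Real.rpow_one] at h
  have e (i j) : _root_.cauchyProfile (D i j) w = 1 + -w ^ 2 * (1 / (D i j ^ 2 + w ^ 2)) := by
    have := (hpos i j).ne'
    unfold _root_.cauchyProfile
    field_simp
    ring
  refine ⟨fun i j => by simp only [e, h.1 i j], fun c hc => ?_⟩
  simp only [e]
  rw [quadForm_add, quadForm_mul_left, quadForm_const hc]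
  nlinarith [mul_nonneg (sq_nonneg w) (h.2 c)]

lemma cauchyProfile_nonneg (t w : ℝ) : 0 ≤ cauchyProfile t w := by
  unfold cauchyProfile; positivity

lemma cauchyProfile_le_one (t w : ℝ) : cauchyProfile t w ≤ 1 :=
  div_le_one_of_le₀ (by nlinarith [sq_nonneg w]) (by positivity)

lemma measurable_cauchyProfile (t : ℝ) : Measurable (cauchyProfile t) := by
  unfold cauchyProfile; fun_prop

lemma integrable_cauchyProfile (t : ℝ) :
    IntegrableOn (cauchyProfile t) (Ioi 0) := by
  rcases eq_or_ne t 0 with rfl | ht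
  · have : cauchyProfile 0 = 0 := by ext; simp [cauchyProfile]
    rw [this]; exact integrable_zero _ _ _
  · have h := (integrable_inv_one_add_sq.comp_mul_left' (inv_ne_zero ht)).integrableOn (s := Ioi 0)
    refine h.congr_fun (fun w _ => ?_) measurableSet_Ioi
    simp only [cauchyProfile]
    field_simp

lemma integral_cauchyProfile {t : ℝ} (ht : 0 ≤ t) :
    ∫ w in Ioi 0, cauchyProfile t w = Real.pi / 2 * t := by
  rcases ht.eq_or_lt with rfl | ht
  · simp [cauchyProfile]
  · have h := integral_comp_mul_left_Ioi (fun w : ℝ => (1 + w ^ 2)⁻¹) 0 (inv_pos.2 ht)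
    rw [mul_zero, integral_Ioi_inv_one_add_sq, Real.arctan_zero, sub_zero, inv_inv,
      smul_eq_mul] at h
    rw [mul_comm, ← h]
    refine setIntegral_congr_fun measurableSet_Ioi fun w _ => ?_
    simp only [cauchyProfile]
    field_simp

lemma integrable_cauchyProfile_mul (t s : ℝ) :
    IntegrableOn (fun w => cauchyProfile t w * cauchyProfile s w) (Ioi 0) := by
  refine (integrable_cauchyProfile t).mono'
    ((measurable_cauchyProfile t).mul (measurable_cauchyProfile s)).aestronglyMeasurable
    (ae_of_all _ fun w => ?_)
  rw [Real.norm_of_nonneg (mul_nonneg (cauchyProfile_nonneg _ _) (cauchyProfile_nonneg _ _))]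
  exact mul_le_of_le_one_right (cauchyProfile_nonneg _ _) (cauchyProfile_le_one _ _)

/-- Partial fractions in w² reduce the product to single profiles; this is where t ≠ s enters. -/
lemma integral_cauchyProfile_mul {t s : ℝ} (ht : 0 ≤ t) (hs : 0 < s) (hts : t ≠ s) :
    ∫ w in Ioi 0, cauchyProfile t w * cauchyProfile s w = Real.pi / 2 * (t * s / (t + s)) := by
  have hne : t - s ≠ 0 := sub_ne_zero.2 hts
  have hp : t + s ≠ 0 := by positivity
  have e : ∀ w ∈ Ioi (0 : ℝ), cauchyProfile t w * cauchyProfile s w =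
      t ^ 2 / ((t - s) * (t + s)) * cauchyProfile s w
      - s ^ 2 / ((t - s) * (t + s)) * cauchyProfile t w := by
    intro w hw
    have hw : 0 < w := hw
    have h1 : t ^ 2 + w ^ 2 ≠ 0 := by positivity
    have h2 : s ^ 2 + w ^ 2 ≠ 0 := by positivity
    unfold cauchyProfile
    field_simp
    ring
  rw [setIntegral_congr_fun measurableSet_Ioi e, integral_sub
    ((integrable_cauchyProfile s).const_mul _) ((integrable_cauchyProfile t).const_mul _),
    integral_const_mul, integral_const_mul, integral_cauchyProfile ht,
    integral_cauchyProfile hs.le]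
  field_simp

lemma isCndKernel_of_sq {D : ι → ι → ℝ} (h0 : ∀ i j, 0 ≤ D i j)
    (hD : IsCndKernel fun i j => D i j ^ 2) : IsCndKernel D := by
  have h := (IsCndKernel.integral (fun i j => integrable_cauchyProfile (D i j))
    ((ae_restrict_iff' measurableSet_Ioi).2 (ae_of_all _ fun w hw =>
      hD.cauchyProfile (mem_Ioi.1 hw)))).mul_left (a := 2 / Real.pi) (by positivity)
  convert h using 3 with i j
  rw [integral_cauchyProfile (h0 i j)]
  field_simp

/-- The profile is averaged with the weight `cauchyProfile s w` ≥ 0. -/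
lemma IsCndKernel.div_add {D : ι → ι → ℝ} (h0 : ∀ i j, 0 ≤ D i j)
    (hD : IsCndKernel fun i j => D i j ^ 2) {s : ℝ} (hs : 0 < s) (hne : ∀ i j, D i j ≠ s) :
    IsCndKernel fun i j => D i j / (D i j + s) := by
  have h := (IsCndKernel.integral (μ := volume.restrict (Ioi 0))
    (fun i j => integrable_cauchyProfile_mul (D i j) s)
    ((ae_restrict_iff' measurableSet_Ioi).2 (ae_of_all _ fun w hw => by
      simpa only [mul_comm] using (hD.cauchyProfile (mem_Ioi.1 hw)).mul_left
        (cauchyProfile_nonneg s w)))).mul_left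
    (a := 2 / Real.pi / s) (by positivity)
  convert h using 3 with i j
  rw [integral_cauchyProfile_mul (h0 i j) hs (hne i j)]
  have : D i j + s ≠ 0 := by have := h0 i j; positivity
  field_simp

/-- The complementary weight 1 - `cauchyProfile s w` ≥ 0 yields t - ts/(t + s) = t²/(t + s). -/
lemma IsCndKernel.sq_div_add {D : ι → ι → ℝ} (h0 : ∀ i j, 0 ≤ D i j)
    (hD : IsCndKernel fun i j => D i j ^ 2) {s : ℝ} (hs : 0 < s) (hne : ∀ i j, D i j ≠ s) :
    IsCndKernel fun i j => D i j ^ 2 / (D i j + s) := by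
  have h := (IsCndKernel.integral (μ := volume.restrict (Ioi 0))
    (k := fun i j w => _root_.cauchyProfile (D i j) w -
      _root_.cauchyProfile (D i j) w * _root_.cauchyProfile s w)
    (fun i j => (integrable_cauchyProfile _).sub (integrable_cauchyProfile_mul (D i j) s))
    ((ae_restrict_iff' measurableSet_Ioi).2 (ae_of_all _ fun w hw => by
      have := (hD.cauchyProfile (mem_Ioi.1 hw)).mul_left
        (sub_nonneg.2 (cauchyProfile_le_one s w))
      convert this using 3
      ring))).mul_left (a := 2 / Real.pi) (by positivity)
  convert h using 3 with i j
  rw [integral_sub (integrable_cauchyProfile _) (integrable_cauchyProfile_mul _ _),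
    integral_cauchyProfile (h0 i j), integral_cauchyProfile_mul (h0 i j) hs (hne i j)]
  have : D i j + s ≠ 0 := by have := h0 i j; positivity
  field_simp
  ring

/-- The integrand in `l` which represents `(1 - t ^ p) / (1 - t)` up to a positive constant. -/
noncomputable def ratioIntegrand (p t l : ℝ) : ℝ :=
  (Real.rpowIntegrand₀₁ p l 1 - Real.rpowIntegrand₀₁ p l t) / (1 - t)

/-- The factor 1 - t cancels: 1/(l + 1) - t/(l + t) = l(1 - t)/((l + 1)(l + t)). -/
lemma ratioIntegrand_eq {p t l : ℝ} (hp : p ∈ Ioo 0 1) (ht : 0 ≤ t) (ht1 : t ≠ 1) (hl : 0 < l) :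
    ratioIntegrand p t l = l ^ (p - 1) * l / (l + 1) * (1 / (t + l)) := by
  have h1 : 1 - t ≠ 0 := sub_ne_zero.2 ht1.symm
  have h2 : l + t ≠ 0 := by positivity
  have h3 : t + l ≠ 0 := by positivity
  rw [ratioIntegrand, Real.rpowIntegrand₀₁_eq_pow_div hp hl.le ht,
    Real.rpowIntegrand₀₁_eq_pow_div hp hl.le zero_le_one]
  rw [add_comm t l] at *
  field_simp
  ring

lemma integrable_ratioIntegrand {p t : ℝ} (hp : p ∈ Ioo 0 1) (ht : 0 ≤ t) :
    IntegrableOn (ratioIntegrand p t) (Ioi 0) :=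
  ((Real.integrableOn_rpowIntegrand₀₁_Ioi hp zero_le_one).sub
    (Real.integrableOn_rpowIntegrand₀₁_Ioi hp ht)).div_const _

lemma integral_ratioIntegrand {p t : ℝ} (hp : p ∈ Ioo 0 1) (ht : 0 ≤ t) :
    ∫ l in Ioi 0, ratioIntegrand p t l =
      (∫ l in Ioi 0, Real.rpowIntegrand₀₁ p l 1) * ((1 - t ^ p) / (1 - t)) := by
  simp only [ratioIntegrand]
  rw [integral_div, integral_sub (Real.integrableOn_rpowIntegrand₀₁_Ioi hp zero_le_one)
    (Real.integrableOn_rpowIntegrand₀₁_Ioi hp ht),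
    Real.integral_rpowIntegrand₀₁_eq_rpow_mul_const hp ht]
  ring

/-- The partial fractions exclude l = D i j, a finite and hence null set of parameters. -/
lemma ae_forall_ne (D : ι → ι → ℝ) : ∀ᵐ l : ℝ, ∀ i j, D i j ≠ l := by
  refine ae_all_iff.2 fun i => ae_all_iff.2 fun j => ?_
  filter_upwards [Measure.ae_ne volume (D i j)] with l hl using hl.symm

lemma IsCndKernel.mul_ratio {D : ι → ι → ℝ} (h0 : ∀ i j, 0 ≤ D i j) (h1 : ∀ i j, D i j ≠ 1)
    {p : ℝ} (hp : p ∈ Ioo 0 1) (n : ℕ)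
    (h : ∀ l > 0, (∀ i j, D i j ≠ l) → IsCndKernel fun i j => D i j ^ n / (D i j + l)) :
    IsCndKernel fun i j => D i j ^ n * ((1 - D i j ^ p) / (1 - D i j)) := by
  have hC := Real.integral_rpowIntegrand₀₁_one_pos hp
  have h := (IsCndKernel.integral (μ := volume.restrict (Ioi 0))
    (k := fun i j l => D i j ^ n * ratioIntegrand p (D i j) l)
    (fun i j => (integrable_ratioIntegrand hp (h0 i j)).const_mul _)
    ((ae_restrict_iff' measurableSet_Ioi).2 (by
      filter_upwards [ae_forall_ne D] with l hl hl0
      have hl0 : 0 < l := hl0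
      have := (h l hl0 hl).mul_left (a := l ^ (p - 1) * l / (l + 1)) (by positivity)
      convert this using 3 with i j
      rw [ratioIntegrand_eq hp (h0 i j) (h1 i j) hl0]
      ring))).mul_left (inv_nonneg.2 hC.le)
  convert h using 3 with i j
  rw [integral_const_mul, integral_ratioIntegrand hp (h0 i j)]
  field_simp

lemma isCndKernel_ratio {D : ι → ι → ℝ} (h0 : ∀ i j, 0 ≤ D i j) (h1 : ∀ i j, D i j ≠ 1)
    (hD : IsCndKernel fun i j => D i j ^ 2) {r : ℝ} (hr1 : 1 ≤ r) (hr3 : r ≤ 3) :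
    IsCndKernel fun i j => (1 - D i j ^ r) / (1 - D i j) := by
  have hne (i j) : 1 - D i j ≠ 0 := sub_ne_zero.2 (h1 i j).symm
  have hc := isCndKernel_const (ι := ι) 1
  have hl := isCndKernel_of_sq h0 hD
  rcases hr1.eq_or_lt with rfl | hr1
  · convert hc using 3 with i j
    rw [Real.rpow_one, div_self (hne i j)]
  rcases lt_trichotomy r 2 with hr2 | rfl | hr2
  · have hp : r - 1 ∈ Ioo (0 : ℝ) 1 := ⟨by linarith, by linarith⟩
    convert hc.add (IsCndKernel.mul_ratio h0 h1 hp 1 fun l hl hl' => by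
      simpa only [pow_one] using IsCndKernel.div_add h0 hD hl hl') using 3 with i j
    -- D i j may vanish, so the exponent rule needs r ≠ 0 rather than a positive base.
    have e : D i j ^ r = D i j * D i j ^ (r - 1) := by
      rw [← Real.rpow_one_add' (h0 i j) (by linarith)]; congr 1; ring
    have := hne i j
    rw [e]
    field_simp
    ring
  · convert hc.add hl using 3 with i j
    have := hne i j
    rw [Real.rpow_ofNat]
    field_simp
    ring
  rcases hr3.eq_or_lt with rfl | hr3
  · convert (hc.add hl).add hD using 3 with i j
    have := hne i j
    rw [Real.rpow_ofNat]
    field_simp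
    ring
  · have hp : r - 2 ∈ Ioo (0 : ℝ) 1 := ⟨by linarith, by linarith⟩
    convert (hc.add hl).add (IsCndKernel.mul_ratio h0 h1 hp 2 fun l hl hl' =>
      IsCndKernel.sq_div_add h0 hD hl hl') using 3 with i j
    have e : D i j ^ r = D i j ^ 2 * D i j ^ (r - 2) := by
      rw [← Real.rpow_natCast, ← Real.rpow_add' (h0 i j) (by push_cast; linarith)]
      congr 1; push_cast; ring
    have := hne i j
    rw [e]
    field_simp
    ring

end Profiles

/-! ### The radial functions g and f -/

section Radial

lemma dslope_rpow_one_of_ne {r t : ℝ} (ht : t ≠ 1) :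
    dslope (fun s : ℝ => s ^ r) 1 t = (1 - t ^ r) / (1 - t) := by
  rw [dslope_of_ne _ ht, slope_def_field, Real.one_rpow, ← neg_sub 1 (t ^ r), ← neg_sub 1 t,
    neg_div_neg_eq]

lemma dslope_rpow_one_self (r : ℝ) : dslope (fun s : ℝ => s ^ r) 1 1 = r := by
  rw [dslope_same]
  simp

lemma continuous_dslope_rpow {r : ℝ} (hr : 0 < r) :
    Continuous (dslope (fun s : ℝ => s ^ r) 1) := by
  rw [← continuousOn_univ, continuousOn_dslope univ_mem]
  exact ⟨(Real.continuous_rpow_const hr.le).continuousOn,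
    (Real.hasDerivAt_rpow_const (Or.inl one_ne_zero)).differentiableAt⟩

lemma dslope_rpow_pos {r t : ℝ} (hr : 0 < r) (ht : 0 ≤ t) :
    0 < dslope (fun s : ℝ => s ^ r) 1 t := by
  rcases lt_trichotomy t 1 with h | rfl | h
  · rw [dslope_rpow_one_of_ne h.ne]
    exact div_pos (sub_pos.2 (Real.rpow_lt_one ht h hr)) (sub_pos.2 h)
  · rwa [dslope_rpow_one_self]
  · rw [dslope_rpow_one_of_ne h.ne']
    exact div_pos_of_neg_of_neg (sub_neg.2 (Real.one_lt_rpow h hr)) (sub_neg.2 h)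

/-- `dslope` fills the removable singularity at norm 1, which gives continuity of g. -/
lemma gFun_eq_dslope (n : ℕ) (r : ℝ) (x : EuclideanSpace ℝ (Fin n)) :
    gFun n r x = dslope (fun s : ℝ => s ^ r) 1 ‖x‖ := by
  unfold gFun
  split_ifs with h
  · rw [h, dslope_rpow_one_self]
  · rw [dslope_rpow_one_of_ne h]

lemma fFun_eq_one_div_gFun (n : ℕ) (r : ℝ) (x : EuclideanSpace ℝ (Fin n)) :
    fFun n r x = 1 / gFun n r x := by
  unfold fFun gFun
  split_ifs
  · rfl
  · rw [one_div_div]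

lemma continuous_gFun (n : ℕ) {r : ℝ} (hr : 0 < r) : Continuous (gFun n r) := by
  simp only [funext (gFun_eq_dslope n r)]
  exact (continuous_dslope_rpow hr).comp continuous_norm

lemma gFun_pos (n : ℕ) {r : ℝ} (hr : 0 < r) (x : EuclideanSpace ℝ (Fin n)) : 0 < gFun n r x := by
  rw [gFun_eq_dslope]
  exact dslope_rpow_pos hr (norm_nonneg x)

lemma eventually_mul_ne_one (d : ℝ) : ∀ᶠ a : ℝ in 𝓝[≠] 1, a * d ≠ 1 := by
  rcases eq_or_ne d 1 with rfl | hd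
  · filter_upwards [self_mem_nhdsWithin] with a ha
    simpa using ha
  · have : Tendsto (fun a : ℝ => a * d) (𝓝[≠] 1) (𝓝 (1 * d)) :=
      ((continuous_mul_const d).tendsto 1).mono_left nhdsWithin_le_nhds
    exact this.eventually_ne (by simpa using hd)

/-- Scaling all distances by a ≠ 1 near 1 avoids the value 1; the inequality passes to the limit a →
1 by continuity. -/
lemma isCndKernel_gFun (n : ℕ) {r : ℝ} (hr1 : 1 ≤ r) (hr3 : r ≤ 3) {ι : Type*} [Fintype ι]
    (x : ι → EuclideanSpace ℝ (Fin n)) : IsCndKernel fun i j => gFun n r (x i - x j) := by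
  refine ⟨fun i j => by simp only [gFun_eq_dslope, norm_sub_rev (x i)], fun c hc => ?_⟩
  have hcont : Continuous fun a : ℝ => quadForm c fun i j =>
      dslope (fun s : ℝ => s ^ r) 1 (a * ‖x i - x j‖) := by
    have := continuous_dslope_rpow (zero_lt_one.trans_le hr1)
    unfold quadForm
    fun_prop
  have hlim := (hcont.tendsto 1).mono_left (nhdsWithin_le_nhds (s := {1}ᶜ))
  simp only [one_mul, ← gFun_eq_dslope] at hlim
  refine le_of_tendsto hlim ?_
  have hall : ∀ᶠ a : ℝ in 𝓝[≠] 1, ∀ i j, a * ‖x i - x j‖ ≠ 1 :=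
    eventually_all.2 fun i => eventually_all.2 fun j => eventually_mul_ne_one _
  filter_upwards [hall, (lt_mem_nhds (zero_lt_one (α := ℝ))).filter_mono nhdsWithin_le_nhds]
    with a ha ha0
  have hD : IsCndKernel fun i j => (a * ‖x i - x j‖) ^ 2 := by
    simp only [mul_pow]
    exact (isCndKernel_norm_sub_sq x).mul_left (sq_nonneg a)
  have h := isCndKernel_ratio (fun i j => mul_nonneg ha0.le (norm_nonneg _)) ha hD hr1 hr3
  simpa only [dslope_rpow_one_of_ne (ha _ _)] using h.2 c hc

lemma isCnd_gFun (n : ℕ) {r : ℝ} (hr1 : 1 ≤ r) (hr3 : r ≤ 3) : IsCnd (gFun n r) :=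
  ⟨continuous_gFun n (zero_lt_one.trans_le hr1), fun _ x =>
    (isCndMatrix_of_iff _).2 (isCndKernel_gFun n hr1 hr3 x)⟩

lemma isInfDiv_fFun (n : ℕ) {r : ℝ} (hr1 : 1 ≤ r) (hr3 : r ≤ 3) : IsInfDiv (fFun n r) := by
  have hr := zero_lt_one.trans_le hr1
  have hf : fFun n r = fun x => 1 / gFun n r x := funext (fFun_eq_one_div_gFun n r)
  refine ⟨?_, fun m x => ⟨fun i j => ?_, fun α hα => ?_⟩⟩
  · rw [hf]
    exact continuous_const.div (continuous_gFun n hr) fun x => (gFun_pos n hr x).ne'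
  · simp only [hf, Matrix.of_apply]
    exact (one_div_pos.2 (gFun_pos n hr _)).le
  · simp only [hf, Matrix.of_apply]
    rcases hα.eq_or_lt with rfl | hα
    -- The Gamma integral needs α > 0; for α = 0 the all-ones matrix is exp(-0).
    · have h := (isCndKernel_const (ι := Fin m) 0).posSemidef_exp_neg
      simpa using h
    · exact (isCndKernel_gFun n hr1 hr3 x).posSemidef_inv_rpow (fun i j => gFun_pos n hr _) hα

/-! ### Necessity of 1 ≤ r ≤ 3 -/

/-- A conditionally negative definite function attains its minimum at the origin. -/
lemma IsCnd.apply_zero_le {E : Type*} [NormedAddCommGroup E] {h : E → ℝ} (hh : IsCnd h) (x : E) :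
    h 0 ≤ h x := by
  obtain ⟨hs, hq⟩ := hh.2 2 ![x, 0]
  have h1 := hq ![1, -1] (by simp)
  have h2 := hs.apply 0 1
  simp [Fin.sum_univ_two] at h1 h2
  linarith

/-- The second difference 1, -2, 1 at 0, x, 2x; it bounds growth under doubling by a factor 4, as
for ‖x‖². -/
lemma IsCnd.apply_two_smul_le {E : Type*} [NormedAddCommGroup E] [NormedSpace ℝ E] {h : E → ℝ}
    (hh : IsCnd h) (x : E) : h ((2 : ℝ) • x) + 3 * h 0 ≤ 4 * h x := by
  obtain ⟨hs, hq⟩ := hh.2 3 ![0, x, (2 : ℝ) • x]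
  have h1 := hq ![1, -2, 1] (by simp [Fin.sum_univ_three]; norm_num)
  have h2 := hs.apply 0 1
  have h3 := hs.apply 0 2
  have e1 : (2 : ℝ) • x - x = x := by rw [two_smul, add_sub_cancel_right]
  have e2 : x - (2 : ℝ) • x = -x := by rw [← neg_sub, e1]
  simp [Fin.sum_univ_three, e1, e2] at h1 h2 h3
  linarith

lemma exists_norm_eq_of_one_le {n : ℕ} (hn : 1 ≤ n) {t : ℝ} (ht : 0 ≤ t) :
    ∃ x : EuclideanSpace ℝ (Fin n), ‖x‖ = t :=
  ⟨EuclideanSpace.single ⟨0, hn⟩ t, by simp [abs_of_nonneg ht]⟩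

lemma gFun_zero (n : ℕ) {r : ℝ} (hr : 0 < r) : gFun n r 0 = 1 := by
  simp [gFun, Real.zero_rpow hr.ne']

lemma one_le_of_isCnd_gFun {n : ℕ} (hn : 1 ≤ n) {r : ℝ} (hr : 0 < r) (h : IsCnd (gFun n r)) :
    1 ≤ r := by
  obtain ⟨x, hx⟩ := exists_norm_eq_of_one_le hn (zero_le_two (α := ℝ))
  have h1 := h.apply_zero_le x
  rw [gFun_zero n hr, gFun_eq_dslope, hx, dslope_rpow_one_of_ne (by norm_num)] at h1
  have h2 : (2 : ℝ) ^ (1 : ℝ) ≤ 2 ^ r := by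
    rw [Real.rpow_one]
    have : (1 - (2 : ℝ) ^ r) / (1 - 2) = 2 ^ r - 1 := by ring
    linarith
  exact (Real.rpow_le_rpow_left_iff one_lt_two).1 h2

lemma le_three_of_isCnd_gFun {n : ℕ} (hn : 1 ≤ n) {r : ℝ} (hr : 0 < r) (h : IsCnd (gFun n r)) :
    r ≤ 3 := by
  -- The doubling inequality at norm t, cleared of denominators and divided by t^r · t so that both
  -- sides converge; the limit t → ∞ reads 2^r ≤ 8.
  have key : ∀ t : ℝ, 1 < t →
      (2 ^ r - (t⁻¹) ^ r) * (1 - t⁻¹) ≤ 4 * ((1 - (t⁻¹) ^ r) * (2 - t⁻¹)) := by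
    intro t ht
    obtain ⟨x, hx⟩ := exists_norm_eq_of_one_le hn (zero_le_one.trans ht.le)
    have h0 : 0 < t := zero_lt_one.trans ht
    have h1 := h.apply_two_smul_le x
    rw [gFun_zero n hr, gFun_eq_dslope, gFun_eq_dslope, norm_smul, hx, Real.norm_ofNat,
      dslope_rpow_one_of_ne (by linarith), dslope_rpow_one_of_ne ht.ne',
      Real.mul_rpow zero_le_two h0.le] at h1
    have hT : 0 < t ^ r := Real.rpow_pos_of_pos h0 r
    rw [Real.inv_rpow h0.le]
    have e1 : (1 - 2 ^ r * t ^ r) / (1 - 2 * t) = (2 ^ r * t ^ r - 1) / (2 * t - 1) := by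
      rw [← neg_div_neg_eq]; ring_nf
    have e2 : (1 - t ^ r) / (1 - t) = (t ^ r - 1) / (t - 1) := by
      rw [← neg_div_neg_eq]; ring_nf
    have h2 : (2 ^ r * t ^ r - 1) / (2 * t - 1) ≤ 4 * (t ^ r - 1) / (t - 1) := by
      rw [e1, e2] at h1
      rw [mul_div_assoc]
      linarith
    rw [div_le_div_iff₀ (by linarith) (by linarith)] at h2
    have hmul : 0 < t ^ r * t := by positivity
    refine le_of_mul_le_mul_right ?_ hmul
    have e3 : (2 ^ r - (t ^ r)⁻¹) * (1 - t⁻¹) * (t ^ r * t) = (2 ^ r * t ^ r - 1) * (t - 1) := by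
      field_simp
    have e4 : 4 * ((1 - (t ^ r)⁻¹) * (2 - t⁻¹)) * (t ^ r * t) =
        4 * (t ^ r - 1) * (2 * t - 1) := by
      field_simp
    rwa [e3, e4]
  have hinv : Tendsto (fun t : ℝ => t⁻¹) atTop (𝓝 0) := tendsto_inv_atTop_zero
  have hpow : Tendsto (fun t : ℝ => (t⁻¹) ^ r) atTop (𝓝 0) := by
    simpa [Real.zero_rpow hr.ne'] using hinv.rpow_const (p := r) (Or.inr hr.le)
  have hlim := le_of_tendsto_of_tendsto
    ((hpow.const_sub (2 ^ r)).mul (hinv.const_sub 1))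
    (((hpow.const_sub 1).mul (hinv.const_sub 2)).const_mul 4)
    ((eventually_gt_atTop 1).mono key)
  have h8 : (2 : ℝ) ^ r ≤ 2 ^ (3 : ℝ) := by
    rw [Real.rpow_ofNat]
    linarith
  exact (Real.rpow_le_rpow_left_iff one_lt_two).1 h8

end Radial

theorem theorem2 (n : ℕ) (hn : 1 ≤ n) (r : ℝ) (hr : 0 < r) :
    (IsCnd (gFun n r) ↔ 1 ≤ r ∧ r ≤ 3) ∧
      (1 ≤ r → r ≤ 3 → IsInfDiv (fFun n r)) :=
  ⟨⟨fun h => ⟨one_le_of_isCnd_gFun hn hr h, le_three_of_isCnd_gFun hn hr h⟩,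
    fun h => isCnd_gFun n h.1 h.2⟩, isInfDiv_fFun n⟩
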